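/- **Setting.** A transition system (TS) $K=\langle\Sigma,W,\hat w,R,L\rangle$ consists of a finite set $\Sigma$ of observations, a finite set $W$ of states with an initial state $\hat w$, a relation $R\subseteq W\times W$ such that every state has an $R$-successor, and a labeling $L:W\to\Sigma$. A fair TS $\mathcal K=\langle K,F\rangle$ is a TS with a set $F\subseteq W$ of Büchi states. A $w$-run is an infinite sequence $u_0,u_1,\dots$ with $u_0=w$ and $(u_i,u_{i+1})\in R$ for all $i\ge 0$; it is fair if some state of $F$ occurs in it infinitely often. Let $\mathcal K=\langle K,F\rangle$ and $\mathcal K'=\langle K',F'\rangle$ be fair TSs over the same $\Sigma$, with states $W,W'$, transition relations $R,R'$ and labelings $L,L'$. A relation $S\subseteq W\times W'$ is a *fair simulation* of $\mathcal K$ by $\mathcal K'$ if for all $(w,w')\in W\times W'$: 1. if $(w,w')\in S$, then $L(w)=L'(w')$; 2. there is a strategy $\tau:(W\times W')^*\times W\to W'$ such that if $(w,w')\in S$ and $u_0,u_1,\dots$ is a fair $w$-run of $\mathcal K$, then its outcome $u'_0,u'_1,\dots$, defined by $u'_i=\tau\big((u_0,u'_0)\cdots(u_{i-1},u'_{i-1}),\,u_i\big)$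 for $i\ge 0$, is a fair $w'$-run of $\mathcal K'$, and $(u_i,u'_i)\in S$ for all $i\ge 0$. Let $\preceq_{\mathsf{fair}}$ be the union of all fair simulations of $\mathcal K$ by $\mathcal K'$. **Game.** Let $G$ be the following two-player game graph. The player 1 vertices are $V_1=\{\langle w,w'\rangle : w\in W,\ w'\in W',\ L(w)=L'(w')\}\cup\{\bot\}$, and the player 2 vertices are $V_2=W\times W'\times\{\$\}$. The edges are - $\langle w_1,w_2\rangle\to\langle w_1',w_2,\$\rangle$ for $\langle w_1,w_2\rangle\in V_1$ and $(w_1,w_1')\in R$; - $\langle w_1',w_2,\$\rangle\to\langle w_1',w_2'\rangle$ for $(w_2,w_2')\in R'$ with $L(w_1')=L'(w_2')$; - $\langle w_1',w_2,\$\rangle\to\bot$ if $L(w_1')\neq L'(w_2')$ for every $w_2'$ with $(w_2,w_2')\in R'$; - $\bot\to\bot$. The owner of the current vertex chooses an outgoing edge; strategies may depend on the whole history of the play. The priorities are $p(\langle w,w'\rangle)=0$ if $w'\in F'$, $p(\langle w,w'\rangle)=1$ if $w\in F$ and $w'\notin F'$, $p(\bot)=1$, and $p(v)=2$ for all other vertices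 $v$. The objective $\Phi^*$ of player 2 is the set of plays in which some vertex of priority $0$ occurs infinitely often or no vertex of priority $1$ occurs infinitely often. Let $W_2(\Phi^*)$ be the set of vertices from which player 2 has a strategy such that, against every strategy of player 1, the resulting play is in $\Phi^*$. Put $$\mathsf{Win}_2=\{(w,w')\in W\times W' : \langle w,w'\rangle\in V_1,\ \langle w,w'\rangle\in W_2(\Phi^*)\}.$$ **Proposition.** Suppose that for every $w\in W$ there is a fair $w$-run of $\mathcal K$. Then $\preceq_{\mathsf{fair}}$ is itself a fair simulation, hence the maximum one, and $\mathsf{Win}_2=\;\preceq_{\mathsf{fair}}$. -/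

import Mathlib

/-- The set of elements that occur infinitely often in an infinite sequence. -/
def infOcc {X : Type*} (s : ℕ → X) : Set X := {x | {k : ℕ | s k = x}.Infinite}

/-- A labeled transition system over the observations `Obs` with state set `W`
(finiteness of `Obs` and `W` is required by type class arguments where it is used);
every state has a successor. -/
structure TS (Obs W : Type*) where
  /-- initial state -/
  init : W
  /-- transition relation -/
  R : W → W → Prop
  /-- labeling function -/
  L : W → Obs
  total : ∀ w, ∃ w', R w w'

/-- `u` is a `w`-run: an infinite path starting in `w`. -/
def TS.IsRun {Obs W : Type*} (K : TS Obs W) (w : W) (u : ℕ → W) : Prop :=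
  u 0 = w ∧ ∀ i, K.R (u i) (u (i + 1))

/-- A fair transition system: a transition system with a set `F` of Büchi states. -/
structure FairTS (Obs W : Type*) extends TS Obs W where
  F : Set W

/-- `u` is a fair `w`-run. -/
def FairTS.IsFairRun {Obs W : Type*} (K : FairTS Obs W) (w : W) (u : ℕ → W) : Prop :=
  K.toTS.IsRun w u ∧ (infOcc u ∩ K.F).Nonempty

/-- A simulation strategy: given the past pairs `(u₀,u₀'), …, (uᵢ₋₁,uᵢ₋₁')` (the empty list if
`i = 0`) and the current state `uᵢ` of the first system, it selects `uᵢ'`. -/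
abbrev SimStrategy (W₁ W₂ : Type*) := List (W₁ × W₂) → W₁ → W₂

/-- The first `i` pairs `(u₀,u₀'), …, (uᵢ₋₁,uᵢ₋₁')` that arise when `τ` is used against `u`. -/
def SimStrategy.history {W₁ W₂ : Type*} (τ : SimStrategy W₁ W₂) (u : ℕ → W₁) :
    ℕ → List (W₁ × W₂)
  | 0 => []
  | i + 1 => SimStrategy.history τ u i ++ [(u i, τ (SimStrategy.history τ u i) (u i))]

/-- The outcome `τ[u] = u₀', u₁', …`, where `uᵢ' = τ((u₀,u₀'), …, (uᵢ₋₁,uᵢ₋₁'), uᵢ)`. -/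
def SimStrategy.outcome {W₁ W₂ : Type*} (τ : SimStrategy W₁ W₂) (u : ℕ → W₁) (i : ℕ) : W₂ :=
  τ (τ.history u i) (u i)

/-- `S` is a fair simulation of `K₁` by `K₂`. -/
def IsFairSimulation {Obs W₁ W₂ : Type*} (K₁ : FairTS Obs W₁) (K₂ : FairTS Obs W₂)
    (S : Set (W₁ × W₂)) : Prop :=
  ∀ (w₁ : W₁) (w₂ : W₂),
    ((w₁, w₂) ∈ S → K₁.L w₁ = K₂.L w₂) ∧
    ∃ τ : SimStrategy W₁ W₂, ∀ u : ℕ → W₁, (w₁, w₂) ∈ S → K₁.IsFairRun w₁ u →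
      K₂.IsFairRun w₂ (τ.outcome u) ∧ ∀ i, (u i, τ.outcome u i) ∈ S

/-- The fair simulation relation: the union of all fair simulations. -/
def fairSimRel {Obs W₁ W₂ : Type*} (K₁ : FairTS Obs W₁) (K₂ : FairTS Obs W₂) :
    Set (W₁ × W₂) :=
  ⋃₀ {S | IsFairSimulation K₁ K₂ S}

/-- A finite two-player game graph. The vertex set is the disjoint union of the set `V₁` of
player 1 vertices and the set `V₂` of player 2 vertices; every vertex has an outgoing edge. -/
structure GameGraph (V₁ V₂ : Type*) where
  E : V₁ ⊕ V₂ → V₁ ⊕ V₂ → Prop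
  finite : Finite (V₁ ⊕ V₂)
  total : ∀ v, ∃ v', E v v'

namespace GameGraph

variable {V₁ V₂ : Type*}

/-- A player 1 strategy: for a past `h` and a current vertex `v` of player 1 it selects a
successor of `v`. -/
structure Strategy₁ (G : GameGraph V₁ V₂) where
  next : List (V₁ ⊕ V₂) → V₁ → V₁ ⊕ V₂
  legal : ∀ h v, G.E (Sum.inl v) (next h v)

/-- A player 2 strategy. -/
structure Strategy₂ (G : GameGraph V₁ V₂) where
  next : List (V₁ ⊕ V₂) → V₂ → V₁ ⊕ V₂
  legal : ∀ h v, G.E (Sum.inr v) (next h v)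

/-- The vertex chosen after the past `h` in the current vertex. -/
def step (G : GameGraph V₁ V₂) (α : G.Strategy₁) (β : G.Strategy₂)
    (h : List (V₁ ⊕ V₂)) : V₁ ⊕ V₂ → V₁ ⊕ V₂
  | Sum.inl v => α.next h v
  | Sum.inr v => β.next h v

/-- The past `v₀, …, vₖ₋₁` and the current vertex `vₖ` after `k` moves. -/
def position (G : GameGraph V₁ V₂) (v : V₁ ⊕ V₂) (α : G.Strategy₁) (β : G.Strategy₂) :
    ℕ → List (V₁ ⊕ V₂) × (V₁ ⊕ V₂)
  | 0 => ([], v)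
  | k + 1 =>
    ((G.position v α β k).1 ++ [(G.position v α β k).2],
      G.step α β (G.position v α β k).1 (G.position v α β k).2)

/-- The unique play `ω(v, α, β)`. -/
def play (G : GameGraph V₁ V₂) (v : V₁ ⊕ V₂) (α : G.Strategy₁) (β : G.Strategy₂) (k : ℕ) :
    V₁ ⊕ V₂ :=
  (G.position v α β k).2

/-- The winning set of player 2 for the objective `Ψ`. -/
def winningSet₂ (G : GameGraph V₁ V₂) (Ψ : Set (ℕ → V₁ ⊕ V₂)) : Set (V₁ ⊕ V₂) :=
  {v | ∃ β : G.Strategy₂, ∀ α : G.Strategy₁, G.play v α β ∈ Ψ}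

end GameGraph

/-- The three-priority parity objective: priority 0 occurs infinitely often, or priority 1 does
not (the least priority that occurs infinitely often is even). -/
def parityObjective {V : Type*} (p : V → Fin 3) : Set (ℕ → V) :=
  {ω | (infOcc ω ∩ p ⁻¹' {0}).Nonempty ∨ infOcc ω ∩ p ⁻¹' {1} = ∅}

/-- Player 1 vertices of the fair simulation game: pairs of states with the same label, and an
additional vertex `sink`. -/
inductive FairSimV₁ {Obs W₁ W₂ : Type*} (K₁ : FairTS Obs W₁) (K₂ : FairTS Obs W₂)
  | pair (w₁ : W₁) (w₂ : W₂) (h : K₁.L w₁ = K₂.L w₂) : FairSimV₁ K₁ K₂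
  | sink : FairSimV₁ K₁ K₂

/-- Player 2 vertices of the fair simulation game: all pairs of states (tagged by `dollar`). -/
inductive FairSimV₂ (W₁ W₂ : Type*)
  | dollar (w₁ : W₁) (w₂ : W₂) : FairSimV₂ W₁ W₂

/-- Edges of the fair simulation game. -/
inductive FairSimEdge {Obs W₁ W₂ : Type*} (K₁ : FairTS Obs W₁) (K₂ : FairTS Obs W₂) :
    FairSimV₁ K₁ K₂ ⊕ FairSimV₂ W₁ W₂ → FairSimV₁ K₁ K₂ ⊕ FairSimV₂ W₁ W₂ → Prop
  | move (w₁ w₁' : W₁) (w₂ : W₂) (h : K₁.L w₁ = K₂.L w₂) (hR : K₁.R w₁ w₁') :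
      FairSimEdge K₁ K₂ (Sum.inl (.pair w₁ w₂ h)) (Sum.inr (.dollar w₁' w₂))
  | reply (w₁' : W₁) (w₂ w₂' : W₂) (hR : K₂.R w₂ w₂') (h : K₁.L w₁' = K₂.L w₂') :
      FairSimEdge K₁ K₂ (Sum.inr (.dollar w₁' w₂)) (Sum.inl (.pair w₁' w₂' h))
  | fail (w₁' : W₁) (w₂ : W₂) (h : ∀ w₂', K₂.R w₂ w₂' → K₁.L w₁' ≠ K₂.L w₂') :
      FairSimEdge K₁ K₂ (Sum.inr (.dollar w₁' w₂)) (Sum.inl .sink)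
  | loop : FairSimEdge K₁ K₂ (Sum.inl .sink) (Sum.inl .sink)

theorem FairSimV₁.finite {Obs W₁ W₂ : Type*} [Finite W₁] [Finite W₂]
    (K₁ : FairTS Obs W₁) (K₂ : FairTS Obs W₂) : Finite (FairSimV₁ K₁ K₂) := by
  let f : FairSimV₁ K₁ K₂ → Option (W₁ × W₂) := fun
    | .pair w₁ w₂ _ => some (w₁, w₂)
    | .sink => none
  refine Finite.of_injective f ?_
  rintro (⟨a, b, h⟩ | _) (⟨c, d, h'⟩ | _) hf <;> simp_all [f]

theorem FairSimV₂.finite {W₁ W₂ : Type*} [Finite W₁] [Finite W₂] :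
    Finite (FairSimV₂ W₁ W₂) := by
  let f : FairSimV₂ W₁ W₂ → W₁ × W₂ := fun
    | .dollar w₁ w₂ => (w₁, w₂)
  refine Finite.of_injective f ?_
  rintro ⟨a, b⟩ ⟨c, d⟩ hf
  simp_all [f]

/-- The game graph for fair simulation. -/
def fairSimGame {Obs W₁ W₂ : Type*} [Finite W₁] [Finite W₂]
    (K₁ : FairTS Obs W₁) (K₂ : FairTS Obs W₂) :
    GameGraph (FairSimV₁ K₁ K₂) (FairSimV₂ W₁ W₂) where
  E := FairSimEdge K₁ K₂
  finite := by
    have := FairSimV₁.finite K₁ K₂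
    have := FairSimV₂.finite (W₁ := W₁) (W₂ := W₂)
    infer_instance
  total := by
    rintro ((⟨w₁, w₂, h⟩ | _) | ⟨w₁, w₂⟩)
    · obtain ⟨w₁', hw⟩ := K₁.total w₁
      exact ⟨_, .move w₁ w₁' w₂ h hw⟩
    · exact ⟨_, .loop⟩
    · by_cases hex : ∃ w₂', K₂.R w₂ w₂' ∧ K₁.L w₁ = K₂.L w₂'
      · obtain ⟨w₂', hR, h⟩ := hex
        exact ⟨_, .reply w₁ w₂ w₂' hR h⟩
      · exact ⟨_, .fail w₁ w₂ fun w₂' hR h => hex ⟨w₂', hR, h⟩⟩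

open Classical in
/-- The priority function of the fair simulation game. -/
noncomputable def fairSimPriority {Obs W₁ W₂ : Type*}
    (K₁ : FairTS Obs W₁) (K₂ : FairTS Obs W₂) :
    FairSimV₁ K₁ K₂ ⊕ FairSimV₂ W₁ W₂ → Fin 3
  | Sum.inl (.pair w₁ w₂ _) => if w₂ ∈ K₂.F then 0 else if w₁ ∈ K₁.F then 1 else 2
  | Sum.inl .sink => 1
  | Sum.inr _ => 2

/-- `Win₂`: the pairs `(w₁, w₂)` that are vertices of the game (equal labels) and from which
player 2 wins the three-priority parity objective. -/
def win₂ {Obs W₁ W₂ : Type*} [Finite W₁] [Finite W₂]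
    (K₁ : FairTS Obs W₁) (K₂ : FairTS Obs W₂) : Set (W₁ × W₂) :=
  {q | ∃ h : K₁.L q.1 = K₂.L q.2,
    (Sum.inl (FairSimV₁.pair q.1 q.2 h) : FairSimV₁ K₁ K₂ ⊕ FairSimV₂ W₁ W₂) ∈
      (fairSimGame K₁ K₂).winningSet₂ (parityObjective (fairSimPriority K₁ K₂))}

/-! Both inclusions translate strategies. Fair simulation reduces to a condition on single pairs,
`SimStrategy.Simulates`: the pairs with equal labels that satisfy it form a fair simulation, since
after any past of a fair run the continued strategy (`shift`) still answers every fair run. On plays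
that alternate between pairs and dollar vertices, the parity objective says: if `F` is visited
infinitely often by `u`, then `F'` is by `u'` (`alternating_mem_parityObjective_iff`). From a
winning strategy, let player 1 move along a fair run: the play avoids the absorbing `sink`, and the
pairs visited give the simulating run (`simulates_toSimStrategy`). Conversely, player 2 copies a
simulation strategy (`play_toStrategy₂`). That strategy promises nothing on non-fair runs, but every
finite prefix extends to a fair run by hypothesis, so each single reply is legal. If the whole run
is fair, the simulation gives fairness of the answer; otherwise the objective holds trivially. -/

open Filter

/-! ### Recurrence in finite sets and the parity condition -/

section InfinitelyOften

/-- Pigeonhole: if each element of `A` occurred only finitely often, finiteness of `A` would bound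
the visits to `A`. -/
theorem infOcc_inter_nonempty_iff {X : Type*} [Finite X] (s : ℕ → X) (A : Set X) :
    (infOcc s ∩ A).Nonempty ↔ ∃ᶠ k in atTop, s k ∈ A := by
  constructor
  · rintro ⟨x, hx, hA⟩
    refine (Nat.frequently_atTop_iff_infinite.2 hx).mono fun k hk => ?_
    rwa [hk]
  · intro h
    have hinf := Nat.frequently_atTop_iff_infinite.1 h
    by_contra hne
    refine hinf ((Set.Finite.biUnion (Set.toFinite A) (t := fun x => {k | s k = x}) ?_).subset ?_)
    · intro x hx
      by_contra hx'
      exact hne ⟨x, hx', hx⟩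
    · intro k hk
      simp only [Set.mem_iUnion]
      exact ⟨s k, hk, rfl⟩

theorem frequently_two_mul_iff {P : ℕ → Prop} (h : ∀ i, ¬ P (2 * i + 1)) :
    (∃ᶠ k in atTop, P k) ↔ ∃ᶠ i in atTop, P (2 * i) := by
  simp only [frequently_atTop]
  constructor
  · intro hP a
    obtain ⟨b, hb, hPb⟩ := hP (2 * a)
    obtain ⟨i, rfl | rfl⟩ := b.even_or_odd'
    · exact ⟨i, by omega, hPb⟩
    · exact absurd hPb (h i)
  · intro hP a
    obtain ⟨b, hb, hPb⟩ := hP a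
    exact ⟨2 * b, by omega, hPb⟩

theorem frequently_add_iff {P : ℕ → Prop} (n : ℕ) :
    (∃ᶠ k in atTop, P (k + n)) ↔ ∃ᶠ k in atTop, P k := by
  rw [← frequently_map (m := fun k => k + n), map_add_atTop_eq_nat]

theorem mem_parityObjective_iff {V : Type*} [Finite V] (p : V → Fin 3) (ω : ℕ → V) :
    ω ∈ parityObjective p ↔
      (∃ᶠ k in atTop, p (ω k) = 0) ∨ ¬ ∃ᶠ k in atTop, p (ω k) = 1 := by
  unfold parityObjective
  rw [Set.mem_ofPred_eq, infOcc_inter_nonempty_iff, ← Set.not_nonempty_iff_eq_empty,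
    infOcc_inter_nonempty_iff]
  rfl

end InfinitelyOften

/-! ### Continuing simulation strategies and splicing fair runs -/

namespace SimStrategy

variable {W₁ W₂ : Type*}

theorem history_congr (τ : SimStrategy W₁ W₂) {u v : ℕ → W₁} {n : ℕ}
    (h : ∀ i < n, u i = v i) : τ.history u n = τ.history v n := by
  induction n with
  | zero => rfl
  | succ n ih =>
    simp only [history, ih fun i hi => h i (by omega), h n (by omega)]

/-- The strategy that continues `τ` after the past `l`. -/
def shift (τ : SimStrategy W₁ W₂) (l : List (W₁ × W₂)) : SimStrategy W₁ W₂ :=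
  fun h w => τ (l ++ h) w

theorem history_shift (τ : SimStrategy W₁ W₂) (u : ℕ → W₁) (k i : ℕ) :
    τ.history u (k + i) =
      τ.history u k ++ (τ.shift (τ.history u k)).history (fun j => u (k + j)) i := by
  induction i with
  | zero => simp [history]
  | succ i ih =>
    rw [← add_assoc]
    simp only [history, ih, shift, List.append_assoc]

theorem outcome_shift (τ : SimStrategy W₁ W₂) (u : ℕ → W₁) (k i : ℕ) :
    (τ.shift (τ.history u k)).outcome (fun j => u (k + j)) i = τ.outcome u (k + i) := by
  simp only [outcome, history_shift τ u k i, shift]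

end SimStrategy

namespace FairTS

variable {Obs W : Type*}

theorem isFairRun_iff [Finite W] (K : FairTS Obs W) (w : W) (u : ℕ → W) :
    K.IsFairRun w u ↔ K.IsRun w u ∧ ∃ᶠ k in atTop, u k ∈ K.F := by
  rw [IsFairRun, infOcc_inter_nonempty_iff]

theorem IsFairRun.drop [Finite W] {K : FairTS Obs W} {w : W} {u : ℕ → W}
    (h : K.IsFairRun w u) (k : ℕ) : K.IsFairRun (u k) fun j => u (k + j) := by
  rw [isFairRun_iff] at h ⊢
  refine ⟨⟨rfl, fun i => h.1.2 (k + i)⟩, ?_⟩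
  simp only [add_comm k]
  exact (frequently_add_iff (P := fun j => u j ∈ K.F) k).2 h.2

/-- A finite path followed by a fair run is a fair run. -/
theorem IsFairRun.concat [Finite W] {K : FairTS Obs W} {u v : ℕ → W} {k : ℕ}
    (hu : ∀ i < k, K.R (u i) (u (i + 1))) (hv : K.IsFairRun (u k) v) :
    K.IsFairRun (u 0) fun j => if j < k then u j else v (j - k) := by
  rw [isFairRun_iff] at hv ⊢
  obtain ⟨⟨h0, hR⟩, hF⟩ := hv
  refine ⟨⟨?_, fun i => ?_⟩, ?_⟩
  · rcases Nat.eq_zero_or_pos k with rfl | hk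
    · simpa using h0
    · simp [hk]
  · rcases lt_trichotomy (i + 1) k with h | h | h
    · simpa [h, (by omega : i < k)] using hu i (by omega)
    · subst h
      simpa [h0] using hu i (by omega)
    · have h1 : ¬ i < k := by omega
      have h2 : ¬ i + 1 < k := by omega
      have h3 : i + 1 - k = i - k + 1 := by omega
      simpa only [if_neg h1, if_neg h2, h3] using hR (i - k)
  · rw [← frequently_add_iff k]
    simpa using hF

end FairTS

/-! ### Fair simulation as a condition on single pairs -/

section Simulation

variable {Obs W₁ W₂ : Type*} (K₁ : FairTS Obs W₁) (K₂ : FairTS Obs W₂)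

/-- The strategy may depend on the initial pair, so each pair uses one from a simulation that
contains it. -/
theorem isFairSimulation_fairSimRel : IsFairSimulation K₁ K₂ (fairSimRel K₁ K₂) := by
  intro w₁ w₂
  refine ⟨fun ⟨S, hS, h⟩ => (hS w₁ w₂).1 h, ?_⟩
  by_cases h : (w₁, w₂) ∈ fairSimRel K₁ K₂
  · obtain ⟨S, hS, h⟩ := h
    obtain ⟨τ, hτ⟩ := (hS w₁ w₂).2
    exact ⟨τ, fun u _ hu => ⟨(hτ u h hu).1, fun i => ⟨S, hS, (hτ u h hu).2 i⟩⟩⟩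
  · exact ⟨fun _ _ => w₂, fun _ h' => absurd h' h⟩

/-- `τ` answers every fair run from `w₁` by a fair run from `w₂` with the same labels. -/
def SimStrategy.Simulates (τ : SimStrategy W₁ W₂) (w₁ : W₁) (w₂ : W₂) : Prop :=
  ∀ u, K₁.IsFairRun w₁ u →
    K₂.IsFairRun w₂ (τ.outcome u) ∧ ∀ i, K₁.L (u i) = K₂.L (τ.outcome u i)

theorem SimStrategy.Simulates.shift [Finite W₁] [Finite W₂] {K₁ : FairTS Obs W₁}
    {K₂ : FairTS Obs W₂} {τ : SimStrategy W₁ W₂} {w₁ : W₁} {w₂ : W₂}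
    (hτ : τ.Simulates K₁ K₂ w₁ w₂) {u : ℕ → W₁} (hu : K₁.IsFairRun w₁ u) (k : ℕ) :
    (τ.shift (τ.history u k)).Simulates K₁ K₂ (u k) (τ.outcome u k) := by
  intro v hv
  -- The original strategy is tested on the fair run that follows `u` up to time `k` and then `v`;
  -- its tail is what the shifted strategy produces on `v`.
  set x : ℕ → W₁ := fun j => if j < k then u j else v (j - k) with hx
  have hxu : ∀ i < k, x i = u i := fun i hi => by simp [hx, hi]
  have hxv : (fun j => x (k + j)) = v := by funext j; simp [hx]
  have hxk : x k = u k := by simpa [hx] using hv.1.1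
  have hhist : τ.history x k = τ.history u k := τ.history_congr hxu
  have hout : τ.outcome x k = τ.outcome u k := by simp only [outcome, hhist, hxk]
  have hfx : K₁.IsFairRun w₁ x := by
    have := FairTS.IsFairRun.concat (k := k) (fun i _ => hu.1.2 i) hv
    rwa [hu.1.1] at this
  obtain ⟨h₁, h₂⟩ := hτ x hfx
  have hshift : (τ.shift (τ.history u k)).outcome v = fun j => τ.outcome x (k + j) := by
    funext j
    rw [← outcome_shift, hxv, hhist]
  refine ⟨?_, fun i => ?_⟩
  · rw [hshift, ← hout]
    exact h₁.drop k
  · rw [hshift, ← h₂ (k + i), ← hxv]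

/-- Equality of labels is demanded separately because `Simulates` is vacuous when no fair run starts
in the first state. -/
theorem isFairSimulation_setOf_simulates [Finite W₁] [Finite W₂] :
    IsFairSimulation K₁ K₂ {q | K₁.L q.1 = K₂.L q.2 ∧
      ∃ τ : SimStrategy W₁ W₂, τ.Simulates K₁ K₂ q.1 q.2} := by
  intro w₁ w₂
  refine ⟨fun h => h.1, ?_⟩
  by_cases h : ∃ τ : SimStrategy W₁ W₂, τ.Simulates K₁ K₂ w₁ w₂
  · obtain ⟨τ, hτ⟩ := h
    exact ⟨τ, fun u _ hu => ⟨(hτ u hu).1, fun i => ⟨(hτ u hu).2 i, _, hτ.shift hu i⟩⟩⟩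
  · exact ⟨fun _ _ => w₂, fun _ h' => absurd h'.2 h⟩

end Simulation

/-! ### Plays and their pasts -/

namespace GameGraph

variable {V₁ V₂ : Type*} (G : GameGraph V₁ V₂)

theorem play_succ_edge (v : V₁ ⊕ V₂) (α : G.Strategy₁) (β : G.Strategy₂) (k : ℕ) :
    G.E (G.play v α β k) (G.play v α β (k + 1)) := by
  simp only [play, position]
  generalize (G.position v α β k).2 = x
  cases x with
  | inl x => exact α.legal _ _
  | inr x => exact β.legal _ _

theorem length_position (v : V₁ ⊕ V₂) (α : G.Strategy₁) (β : G.Strategy₂) (k : ℕ) :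
    (G.position v α β k).1.length = k := by
  induction k with
  | zero => rfl
  | succ k ih => simp [position, ih]

theorem position_succ_fst (v : V₁ ⊕ V₂) (α : G.Strategy₁) (β : G.Strategy₂) (k : ℕ) :
    (G.position v α β (k + 1)).1 = (G.position v α β k).1 ++ [G.play v α β k] := rfl

theorem play_succ_of_inl {v : V₁ ⊕ V₂} {α : G.Strategy₁} {β : G.Strategy₂} {k : ℕ} {x : V₁}
    (h : G.play v α β k = Sum.inl x) :
    G.play v α β (k + 1) = α.next (G.position v α β k).1 x := by
  rw [play] at h
  simp only [play, position, h, step]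

theorem play_succ_of_inr {v : V₁ ⊕ V₂} {α : G.Strategy₁} {β : G.Strategy₂} {k : ℕ} {x : V₂}
    (h : G.play v α β k = Sum.inr x) :
    G.play v α β (k + 1) = β.next (G.position v α β k).1 x := by
  rw [play] at h
  simp only [play, position, h, step]

end GameGraph

/-! ### The fair simulation game -/

section Game

variable {Obs W₁ W₂ : Type*} [Finite W₁] [Finite W₂] (K₁ : FairTS Obs W₁) (K₂ : FairTS Obs W₂)

theorem alternating_mem_parityObjective_iff {ω : ℕ → FairSimV₁ K₁ K₂ ⊕ FairSimV₂ W₁ W₂}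
    {u : ℕ → W₁} {u' : ℕ → W₂} (heven : ∀ i, ∃ h, ω (2 * i) = Sum.inl (.pair (u i) (u' i) h))
    (hodd : ∀ i, ∃ x, ω (2 * i + 1) = Sum.inr x) :
    ω ∈ parityObjective (fairSimPriority K₁ K₂) ↔
      ((∃ᶠ i in atTop, u i ∈ K₁.F) → ∃ᶠ i in atTop, u' i ∈ K₂.F) := by
  have := (fairSimGame K₁ K₂).finite
  have hp : ∀ i, fairSimPriority K₁ K₂ (ω (2 * i + 1)) = 2 := fun i => by
    obtain ⟨x, hx⟩ := hodd i
    rw [hx]; rfl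
  have h0 : ∀ i, fairSimPriority K₁ K₂ (ω (2 * i)) = 0 ↔ u' i ∈ K₂.F := fun i => by
    obtain ⟨h, hx⟩ := heven i
    rw [hx]
    by_cases h1 : u i ∈ K₁.F <;> by_cases h2 : u' i ∈ K₂.F <;> simp [fairSimPriority, h1, h2]
  have h1 : ∀ i, fairSimPriority K₁ K₂ (ω (2 * i)) = 1 ↔ u i ∈ K₁.F ∧ u' i ∉ K₂.F := fun i => by
    obtain ⟨h, hx⟩ := heven i
    rw [hx]
    by_cases h1 : u i ∈ K₁.F <;> by_cases h2 : u' i ∈ K₂.F <;> simp [fairSimPriority, h1, h2]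
  rw [mem_parityObjective_iff, frequently_two_mul_iff (P := fun k => fairSimPriority K₁ K₂ (ω k) = 0) (fun i => by simp [hp]),
    frequently_two_mul_iff (P := fun k => fairSimPriority K₁ K₂ (ω k) = 1) (fun i => by simp [hp])]
  simp only [h0, h1]
  by_cases hF : ∃ᶠ i in atTop, u' i ∈ K₂.F
  · simp [hF]
  · simp only [hF, false_or, imp_false]
    rw [not_iff_not]
    -- Here `F'` is eventually avoided, so visits to `F` and visits to priority 1 eventually
    -- coincide.
    exact ⟨fun h => h.mono fun _ hi => hi.1, fun h => h.and_eventually (not_frequently.1 hF)⟩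

/-- The sink is absorbing with priority 1, so a play that enters it is lost for player 2. -/
theorem play_ne_sink_of_mem_parityObjective {v : FairSimV₁ K₁ K₂ ⊕ FairSimV₂ W₁ W₂}
    {α : (fairSimGame K₁ K₂).Strategy₁} {β : (fairSimGame K₁ K₂).Strategy₂}
    (h : (fairSimGame K₁ K₂).play v α β ∈ parityObjective (fairSimPriority K₁ K₂)) (k : ℕ) :
    (fairSimGame K₁ K₂).play v α β k ≠ Sum.inl .sink := by
  have := (fairSimGame K₁ K₂).finite
  intro hk
  have hsink : ∀ j, (fairSimGame K₁ K₂).play v α β (j + k) = Sum.inl .sink := by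
    intro j
    induction j with
    | zero => simpa using hk
    | succ j ih =>
      have hE := (fairSimGame K₁ K₂).play_succ_edge v α β (j + k)
      rw [ih] at hE
      rw [add_right_comm]
      generalize (fairSimGame K₁ K₂).play v α β (j + k + 1) = y at hE
      cases hE
      rfl
  rw [mem_parityObjective_iff, ← frequently_add_iff k,
    ← frequently_add_iff (P := fun j => _ = 1) k] at h
  simp only [hsink, fairSimPriority] at h
  simp [atTop_neBot.ne] at h

/-- The pair recorded at a game vertex of player 1. -/
def pairOfVertex : FairSimV₁ K₁ K₂ ⊕ FairSimV₂ W₁ W₂ → Option (W₁ × W₂)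
  | Sum.inl (.pair a b _) => some (a, b)
  | _ => none

open Classical in
/-- The player 2 strategy that follows a simulation strategy as long as this is legal. -/
noncomputable def SimStrategy.toStrategy₂ (τ : SimStrategy W₁ W₂) :
    (fairSimGame K₁ K₂).Strategy₂ where
  next h v := match v with
    | .dollar w b =>
      if hw : K₁.L w = K₂.L (τ (h.filterMap (pairOfVertex K₁ K₂)) w) ∧
          K₂.R b (τ (h.filterMap (pairOfVertex K₁ K₂)) w) then
        Sum.inl (.pair w (τ (h.filterMap (pairOfVertex K₁ K₂)) w) hw.1)
      else ((fairSimGame K₁ K₂).total (Sum.inr (.dollar w b))).choose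
  legal h v := by
    obtain ⟨w, b⟩ := v
    dsimp only
    split_ifs with hw
    · exact .reply _ _ _ hw.2 hw.1
    · exact ((fairSimGame K₁ K₂).total (Sum.inr (.dollar w b))).choose_spec

theorem SimStrategy.toStrategy₂_next (τ : SimStrategy W₁ W₂)
    (h : List (FairSimV₁ K₁ K₂ ⊕ FairSimV₂ W₁ W₂)) (w : W₁) (b : W₂)
    (hL : K₁.L w = K₂.L (τ (h.filterMap (pairOfVertex K₁ K₂)) w))
    (hR : K₂.R b (τ (h.filterMap (pairOfVertex K₁ K₂)) w)) :
    (τ.toStrategy₂ K₁ K₂).next h (.dollar w b) = Sum.inl (.pair w _ hL) :=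
  dif_pos ⟨hL, hR⟩

theorem SimStrategy.Simulates.play_toStrategy₂ {K₁ : FairTS Obs W₁} {K₂ : FairTS Obs W₂}
    (hfair : ∀ w : W₁, ∃ u : ℕ → W₁, K₁.IsFairRun w u) {τ : SimStrategy W₁ W₂}
    {w₁ : W₁} {w₂ : W₂} (hτ : τ.Simulates K₁ K₂ w₁ w₂) (hL : K₁.L w₁ = K₂.L w₂)
    (α : (fairSimGame K₁ K₂).Strategy₁) :
    (fairSimGame K₁ K₂).play (Sum.inl (.pair w₁ w₂ hL)) α (τ.toStrategy₂ K₁ K₂) ∈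
      parityObjective (fairSimPriority K₁ K₂) := by
  set β := τ.toStrategy₂ K₁ K₂ with hβ
  set v : FairSimV₁ K₁ K₂ ⊕ FairSimV₂ W₁ W₂ := Sum.inl (.pair w₁ w₂ hL)
  -- The default is never used: `key` shows that every even position is a pair.
  let u : ℕ → W₁ := fun i => ((pairOfVertex K₁ K₂ ((fairSimGame K₁ K₂).play v α β (2 * i))).getD (w₁, w₂)).1
  have hu0 : u 0 = w₁ := rfl
  have key : ∀ i, (∃ h, (fairSimGame K₁ K₂).play v α β (2 * i) = Sum.inl (.pair (u i) (τ.outcome u i) h)) ∧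
      ((fairSimGame K₁ K₂).position v α β (2 * i)).1.filterMap (pairOfVertex K₁ K₂) = τ.history u i ∧
      (∀ j < i, K₁.R (u j) (u (j + 1))) ∧
      (∀ j < i, ∃ x, (fairSimGame K₁ K₂).play v α β (2 * j + 1) = Sum.inr x) := by
    intro i
    induction i with
    | zero =>
      have hout : τ.outcome u 0 = w₂ := by
        -- The first reply depends only on the initial state, so any fair run from `w₁` forces it to
        -- be `w₂`.
        obtain ⟨x, hx⟩ := hfair w₁
        rw [← (hτ x hx).1.1.1]
        simp only [outcome, history, hu0, hx.1.1]
      refine ⟨?_, rfl, by simp, by simp⟩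
      rw [hout]
      exact ⟨hL, rfl⟩
    | succ i ih =>
      obtain ⟨⟨hl, hp⟩, hh, hR, hd⟩ := ih
      obtain ⟨w', hw', hp1⟩ : ∃ w', K₁.R (u i) w' ∧
          (fairSimGame K₁ K₂).play v α β (2 * i + 1) = Sum.inr (.dollar w' (τ.outcome u i)) := by
        have hE := (fairSimGame K₁ K₂).play_succ_edge v α β (2 * i)
        rw [hp] at hE
        generalize (fairSimGame K₁ K₂).play v α β (2 * i + 1) = y at hE
        cases hE with
        | move _ w' _ _ hR => exact ⟨w', hR, rfl⟩
      have hh1 : ((fairSimGame K₁ K₂).position v α β (2 * i + 1)).1.filterMap (pairOfVertex K₁ K₂) =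
          τ.history u (i + 1) := by
        rw [(fairSimGame K₁ K₂).position_succ_fst, List.filterMap_append, hh, hp]
        rfl
      obtain ⟨hl', hR'⟩ : K₁.L w' = K₂.L (τ (τ.history u (i + 1)) w') ∧
          K₂.R (τ.outcome u i) (τ (τ.history u (i + 1)) w') := by
        obtain ⟨y, hy⟩ := hfair w'
        set x : ℕ → W₁ := fun j => if j < i + 1 then u j else y (j - (i + 1)) with hx
        have hxu : ∀ j < i + 1, x j = u j := fun j hj => by simp only [hx, if_pos hj]
        have hxs : x (i + 1) = w' := by simpa [hx] using hy.1.1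
        have hfx : K₁.IsFairRun w₁ x := by
          -- The state at time `i + 1` is set to `w'` by hand: that `u (i + 1) = w'` is known only
          -- after the reply has been shown legal.
          have := FairTS.IsFairRun.concat (K := K₁)
            (u := fun j => if j < i + 1 then u j else w') (v := y) (k := i + 1) ?_ (by simpa using hy)
          · rw [if_pos (by omega), hu0] at this
            convert this using 2 with j
            by_cases hj : j < i + 1 <;> simp only [hx, hj, if_true, if_false]
          · intro j hj
            rcases Nat.lt_succ_iff_lt_or_eq.1 hj with hj' | rfl
            · simpa [hj, hj'] using hR j hj'
            · simpa using hw'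
        obtain ⟨h₁, h₂⟩ := hτ x hfx
        have e1 : τ.outcome x i = τ.outcome u i := by
          simp only [outcome, hxu i (by omega),
            τ.history_congr (n := i) fun j hj => hxu j (by omega)]
        have e2 : τ.outcome x (i + 1) = τ (τ.history u (i + 1)) w' := by
          simp only [outcome, τ.history_congr hxu, hxs]
        rw [← e1, ← e2, ← hxs]
        exact ⟨h₂ _, h₁.1.2 i⟩
      have hp2 : (fairSimGame K₁ K₂).play v α β (2 * (i + 1)) =
          Sum.inl (.pair w' (τ (τ.history u (i + 1)) w') hl') := by
        rw [show 2 * (i + 1) = 2 * i + 1 + 1 by ring, (fairSimGame K₁ K₂).play_succ_of_inr hp1, hβ, toStrategy₂_next] <;>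
          simp only [← hβ, hh1, hl', hR']
      have hus : u (i + 1) = w' := by simp only [u, hp2]; rfl
      refine ⟨?_, ?_, ?_, ?_⟩
      · have : τ.outcome u (i + 1) = τ (τ.history u (i + 1)) w' := by simp only [outcome, hus]
        rw [this, hus]
        exact ⟨hl', hp2⟩
      · rw [show 2 * (i + 1) = 2 * i + 1 + 1 by ring, (fairSimGame K₁ K₂).position_succ_fst, List.filterMap_append, hh1, hp1]
        simp [pairOfVertex]
      · intro j hj
        rcases Nat.lt_succ_iff_lt_or_eq.1 hj with hj' | rfl
        · exact hR j hj'
        · rwa [hus]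
      · intro j hj
        rcases Nat.lt_succ_iff_lt_or_eq.1 hj with hj' | rfl
        · exact hd j hj'
        · exact ⟨_, hp1⟩
  refine (alternating_mem_parityObjective_iff K₁ K₂ (fun i => (key i).1)
    (fun i => (key (i + 1)).2.2.2 i (by omega))).2 fun hF => ?_
  have hu : K₁.IsFairRun w₁ u :=
    (K₁.isFairRun_iff _ _).2 ⟨⟨hu0, fun i => (key (i + 1)).2.2.1 i (by omega)⟩, hF⟩
  exact ((K₂.isFairRun_iff _ _).1 (hτ u hu).1).2

open Classical in
/-- The player 1 vertex of a pair of states. -/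
noncomputable def vertexOfPair (q : W₁ × W₂) : FairSimV₁ K₁ K₂ ⊕ FairSimV₂ W₁ W₂ :=
  if h : K₁.L q.1 = K₂.L q.2 then Sum.inl (.pair q.1 q.2 h) else Sum.inl .sink

/-- The game history that belongs to a list of pairs, given in reverse order. -/
noncomputable def gameHistory :
    List (W₁ × W₂) → List (FairSimV₁ K₁ K₂ ⊕ FairSimV₂ W₁ W₂)
  | [] => []
  | [q] => [vertexOfPair K₁ K₂ q]
  | q :: r :: t => gameHistory (r :: t) ++ [Sum.inr (.dollar q.1 r.2), vertexOfPair K₁ K₂ q]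

/-- The simulation strategy that starts in `w₂` and follows a player 2 strategy. -/
noncomputable def GameGraph.Strategy₂.toSimStrategy (β : (fairSimGame K₁ K₂).Strategy₂)
    (w₂ : W₂) : SimStrategy W₁ W₂ := fun l w =>
  match l.reverse with
  | [] => w₂
  | q :: t =>
    -- After reversal `q` is the latest pair. The default covers a move to the sink, which a winning
    -- play never makes.
    ((pairOfVertex K₁ K₂ (β.next (gameHistory K₁ K₂ (q :: t)) (.dollar w q.2))).getD (w, w₂)).2

open Classical in
/-- The player 1 strategy that moves along the run `u` as long as this is legal. -/
noncomputable def runStrategy₁ (u : ℕ → W₁) : (fairSimGame K₁ K₂).Strategy₁ where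
  next h v := match v with
    | .pair a b hL =>
      -- The pair with index `i` sits at position `2 * i`, where the past has length `2 * i`; the
      -- next state of the run is `u (i + 1)`.
      if K₁.R a (u (h.length / 2 + 1)) then Sum.inr (.dollar (u (h.length / 2 + 1)) b)
      else ((fairSimGame K₁ K₂).total (Sum.inl (.pair a b hL))).choose
    | .sink => Sum.inl .sink
  legal h v := by
    rcases v with ⟨a, b, hL⟩ | _
    · dsimp only
      split_ifs with hR
      · exact .move _ _ _ _ hR
      · exact ((fairSimGame K₁ K₂).total (Sum.inl (.pair a b hL))).choose_spec
    · exact .loop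

theorem runStrategy₁_next (u : ℕ → W₁) (h : List (FairSimV₁ K₁ K₂ ⊕ FairSimV₂ W₁ W₂))
    (a : W₁) (b : W₂) (hL : K₁.L a = K₂.L b) (hR : K₁.R a (u (h.length / 2 + 1))) :
    (runStrategy₁ K₁ K₂ u).next h (.pair a b hL) =
      Sum.inr (.dollar (u (h.length / 2 + 1)) b) :=
  if_pos hR

theorem GameGraph.Strategy₂.toSimStrategy_of_reverse {β : (fairSimGame K₁ K₂).Strategy₂}
    {w₂ : W₂} {l t : List (W₁ × W₂)} {q : W₁ × W₂} (hl : l.reverse = q :: t) (w : W₁) :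
    β.toSimStrategy K₁ K₂ w₂ l w = ((pairOfVertex K₁ K₂
      (β.next (gameHistory K₁ K₂ l.reverse) (.dollar w q.2))).getD (w, w₂)).2 := by
  simp only [toSimStrategy, hl]

theorem simulates_toSimStrategy {w₁ : W₁} {w₂ : W₂} (hL : K₁.L w₁ = K₂.L w₂)
    {β : (fairSimGame K₁ K₂).Strategy₂}
    (hβ : ∀ α, (fairSimGame K₁ K₂).play (Sum.inl (.pair w₁ w₂ hL)) α β ∈
      parityObjective (fairSimPriority K₁ K₂)) :
    (β.toSimStrategy K₁ K₂ w₂).Simulates K₁ K₂ w₁ w₂ := by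
  intro u hu
  set τ := β.toSimStrategy K₁ K₂ w₂ with hτ
  set v : FairSimV₁ K₁ K₂ ⊕ FairSimV₂ W₁ W₂ := Sum.inl (.pair w₁ w₂ hL) with hv
  set α := runStrategy₁ K₁ K₂ u with hα
  have hwin := hβ α
  have hns := play_ne_sink_of_mem_parityObjective K₁ K₂ hwin
  have hodd_of : ∀ i h, (fairSimGame K₁ K₂).play v α β (2 * i) = Sum.inl (.pair (u i) (τ.outcome u i) h) →
      (fairSimGame K₁ K₂).play v α β (2 * i + 1) = Sum.inr (.dollar (u (i + 1)) (τ.outcome u i)) := by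
    intro i h hp
    rw [(fairSimGame K₁ K₂).play_succ_of_inl hp, hα, runStrategy₁_next] <;>
      simp only [(fairSimGame K₁ K₂).length_position, Nat.mul_div_cancel_left i two_pos, hu.1.2 i]
  have hrev : ∀ i, (τ.history u (i + 1)).reverse =
      (u i, τ.outcome u i) :: (τ.history u i).reverse := fun i => by
    simp [SimStrategy.history, SimStrategy.outcome]
  have key : ∀ i, (∃ h, (fairSimGame K₁ K₂).play v α β (2 * i) = Sum.inl (.pair (u i) (τ.outcome u i) h)) ∧
      ((fairSimGame K₁ K₂).position v α β (2 * i + 1)).1 = gameHistory K₁ K₂ (τ.history u (i + 1)).reverse ∧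
      (∀ j < i, K₂.R (τ.outcome u j) (τ.outcome u (j + 1))) := by
    intro i
    induction i with
    | zero =>
      have hout : τ.outcome u 0 = w₂ := rfl
      have hu0 : u 0 = w₁ := hu.1.1
      refine ⟨?_, ?_, by simp⟩
      · rw [hout, hu0]
        exact ⟨hL, rfl⟩
      · rw [hrev, hout, hu0]
        simp [SimStrategy.history, gameHistory, vertexOfPair, hL, GameGraph.position, hv]
    | succ i ih =>
      obtain ⟨⟨hl, hp⟩, hh, hR⟩ := ih
      have hp1 := hodd_of i hl hp
      have hnext : (fairSimGame K₁ K₂).play v α β (2 * (i + 1)) =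
          β.next (gameHistory K₁ K₂ (τ.history u (i + 1)).reverse)
            (.dollar (u (i + 1)) (τ.outcome u i)) := by
        rw [show 2 * (i + 1) = 2 * i + 1 + 1 by ring, (fairSimGame K₁ K₂).play_succ_of_inr hp1, hh]
      have hout : τ.outcome u (i + 1) =
          ((pairOfVertex K₁ K₂ ((fairSimGame K₁ K₂).play v α β (2 * (i + 1)))).getD (u (i + 1), w₂)).2 := by
        rw [hnext]
        exact GameGraph.Strategy₂.toSimStrategy_of_reverse K₁ K₂ (hrev i) _
      obtain ⟨b, hb, hRb, hp2⟩ : ∃ b, ∃ hb : K₁.L (u (i + 1)) = K₂.L b,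
          K₂.R (τ.outcome u i) b ∧ (fairSimGame K₁ K₂).play v α β (2 * (i + 1)) = Sum.inl (.pair _ _ hb) := by
        have hE := (fairSimGame K₁ K₂).play_succ_edge v α β (2 * i + 1)
        have hn := hns (2 * (i + 1))
        rw [hp1] at hE
        change FairSimEdge K₁ K₂ _ ((fairSimGame K₁ K₂).play v α β (2 * (i + 1))) at hE
        change (fairSimGame K₁ K₂).play v α β (2 * (i + 1)) ≠ _ at hn
        generalize (fairSimGame K₁ K₂).play v α β (2 * (i + 1)) = y at hE hn
        -- A dollar vertex leads to a pair or to the sink, and the sink is excluded because `β`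
        -- wins.
        cases hE with
        | reply _ _ b hR h => exact ⟨b, h, hR, rfl⟩
        | fail => exact absurd rfl hn
      have hob : τ.outcome u (i + 1) = b := by rw [hout, hp2]; rfl
      refine ⟨?_, ?_, ?_⟩
      · rw [hob]
        exact ⟨hb, hp2⟩
      · rw [hrev, hrev, gameHistory, ← hrev, (fairSimGame K₁ K₂).position_succ_fst, hp2,
          show 2 * (i + 1) = 2 * i + 1 + 1 by ring, (fairSimGame K₁ K₂).position_succ_fst, hh, hp1, hob]
        simp [vertexOfPair, hb]
      · intro j hj
        rcases Nat.lt_succ_iff_lt_or_eq.1 hj with hj' | rfl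
        · exact hR j hj'
        · rwa [hob]
  -- Each pair vertex carries the proof that its labels agree.
  refine ⟨?_, fun i => (key i).1.choose⟩
  rw [FairTS.isFairRun_iff] at hu ⊢
  exact ⟨⟨rfl, fun i => (key (i + 1)).2.2 i (by omega)⟩,
    (alternating_mem_parityObjective_iff K₁ K₂ (fun i => (key i).1)
      (fun i => ⟨_, hodd_of i _ (key i).1.choose_spec⟩)).1 hwin hu.2⟩

end Game

theorem mainTheorem6 {Obs W₁ W₂ : Type*} [Finite Obs] [Finite W₁] [Finite W₂]
    (K₁ : FairTS Obs W₁) (K₂ : FairTS Obs W₂)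
    (hfair : ∀ w : W₁, ∃ u : ℕ → W₁, K₁.IsFairRun w u) :
    IsGreatest {S : Set (W₁ × W₂) | IsFairSimulation K₁ K₂ S} (fairSimRel K₁ K₂) ∧
      win₂ K₁ K₂ = fairSimRel K₁ K₂ := by
  refine ⟨⟨isFairSimulation_fairSimRel K₁ K₂, fun S hS => Set.subset_sUnion_of_mem hS⟩,
    Set.Subset.antisymm ?_ ?_⟩
  · rintro ⟨w₁, w₂⟩ ⟨hL, β, hβ⟩
    exact ⟨_, isFairSimulation_setOf_simulates K₁ K₂, hL, _,
      simulates_toSimStrategy K₁ K₂ hL hβ⟩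
  · rintro ⟨w₁, w₂⟩ h
    obtain ⟨hL, τ, hτ⟩ := isFairSimulation_fairSimRel K₁ K₂ w₁ w₂
    have hsim : τ.Simulates K₁ K₂ w₁ w₂ := fun u hu =>
      ⟨(hτ u h hu).1, fun i => (isFairSimulation_fairSimRel K₁ K₂ _ _).1 ((hτ u h hu).2 i)⟩
    exact ⟨hL h, τ.toStrategy₂ K₁ K₂, fun α => hsim.play_toStrategy₂ hfair (hL h) α⟩
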